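/- Conventions. A Gray-category $\mathcal K$ is a category enriched in $2$-categories with the Gray tensor product: it has (strict) hom $2$-categories $\mathcal K(A,B)$ and strictly associative and unital composition cubical functors $\mathcal K(B,C)\times\mathcal K(A,B)\to\mathcal K(A,C)$, $(G,F)\mapsto GF$. For $f\colon F\Rightarrow F'$ in $\mathcal K(A,B)$ and $g\colon G\Rightarrow G'$ in $\mathcal K(B,C)$ the interchange 3-isomorphism is $g_f\colon G'f\circ gF\to gF'\circ Gf$. A Gray-monoid is a Gray-category with one object; for an object $B$, the 2-category $\mathcal K(B,B)$ is a Gray-monoid under composition. A pseudoadjunction $I,E,i,e\colon F\dashv_p U\colon A\to B$ consists of morphisms $U\colon A\to B$, $F\colon B\to A$, 2-morphisms $i\colon 1_B\Rightarrow UF$ (unit), $e\colon FU\Rightarrow 1_A$ (counit), and 3-isomorphisms $I\colon 1_U\to Ue\circ iU$, $E\colon eF\circ Fi\to 1_F$, such that the pastings $$e\xrightarrow{e\circ FI}e\circ FUe\circ FiU\xrightarrow{e_e^{-1}\circ FiU}e\circ eFU\circ FiU\xrightarrow{e\circ EU}e,$$ $$i\xrightarrow{IF\circ i}UeF\circ iUF\circ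 i\xrightarrow{UeF\circ i_i^{-1}}UeF\circ UFi\circ i\xrightarrow{UE\circ i}i$$ are identities. A pseudo ambijunction $I,E,J,K,i,e,j,k\colon F\dashv_p U\dashv_p F$ consists of pseudoadjunctions $I,E,i,e\colon F\dashv_p U$ and $J,K,j,k\colon U\dashv_p F$; thus $k\colon UF\Rightarrow 1_B$. A pseudomonad $(T,\mu,\eta,\lambda,\rho,\alpha)$ on $B$ consists of $T\colon B\to B$, 2-morphisms $\mu\colon TT\Rightarrow T$, $\eta\colon 1_B\Rightarrow T$ and 3-isomorphisms $\lambda\colon\mu\circ\eta T\to 1_T$, $\rho\colon 1_T\to\mu\circ T\eta$, $\alpha\colon\mu\circ T\mu\to\mu\circ\mu T$ with $$(\mu\circ\alpha T)\cdot(\alpha\circ T\mu T)\cdot(\mu\circ T\alpha)=(\alpha\circ\mu TT)\cdot(\mu\circ\mu_\mu^{-1})\cdot(\alpha\circ TT\mu),$$ $$\alpha\circ T\eta T=(\mu\circ\rho T)\cdot(\mu\circ T\lambda).$$ A Frobenius pseudomonad is a pseudomonad equipped with a 2-morphism $\varepsilon\colon T\Rightarrow 1_B$ such that $\varepsilon\circ\mu$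 is the counit of a specified pseudoadjunction $T\dashv_p T$. A Frobenius pseudomonoid in a Gray-monoid is a Frobenius pseudomonad on its unique object. Theorem. Let $I,E,J,K,i,e,j,k\colon F\dashv_p U\dashv_p F\colon A\to B$ be a pseudo ambijunction in a Gray-category $\mathcal K$. Then the data $$\bigl(UF,\ \mu=UeF,\ \eta=i,\ \lambda=(IF)^{-1},\ \rho=(UE)^{-1},\ \alpha=U(e_e^{-1})F\bigr)$$ form a pseudomonad on $B$ (the pseudomonad induced by $F\dashv_p U$), and this pseudomonad together with $\varepsilon=k$ is a Frobenius pseudomonad. Equivalently, $UF$ with the same data is a Frobenius pseudomonoid in the Gray-monoid $\mathcal K(B,B)$. -/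

import Mathlib

open CategoryTheory Bicategory

universe u v w z

namespace Gray

/-! ### Cells of a 2-category

A 2-category is a Mathlib bicategory that is `Bicategory.Strict`. Since composition is associative
and unital up to equality only, we collect all 1-cells (and all 2-cells) of a 2-category in one
type, so that equations between cells with equal, but not syntactically equal, boundaries can be
written as equations. Composites are only formed of cells whose boundaries match. -/

section Cells

variable {X : Type v} [Bicategory.{z, w} X]

/-- A 1-cell of `X` together with its source and target. -/
structure OneCell (X : Type v) [Bicategory.{z, w} X] where
  {src : X}
  {tgt : X}
  hom : src ⟶ tgt

/-- A 2-cell of `X` together with its boundary. -/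
structure TwoCell (X : Type v) [Bicategory.{z, w} X] where
  {src : X}
  {tgt : X}
  {domHom : src ⟶ tgt}
  {codHom : src ⟶ tgt}
  hom : domHom ⟶ codHom

/-- An invertible 2-cell of `X` together with its boundary. -/
structure IsoCell (X : Type v) [Bicategory.{z, w} X] where
  {src : X}
  {tgt : X}
  {domHom : src ⟶ tgt}
  {codHom : src ⟶ tgt}
  iso : domHom ≅ codHom

namespace OneCell

/-- The identity 1-cell. -/
def id (x : X) : OneCell X := ⟨𝟙 x⟩

/-- Composition of 1-cells: first `f`, then `g`. -/
def comp : (f g : OneCell X) → (h : f.tgt = g.src := by simp [*]) → OneCell X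
  | ⟨f⟩, ⟨g⟩, rfl => ⟨f ≫ g⟩

/-- The 1-cell `f`, regarded as a morphism between objects equal to its source and target. -/
def homOf : (f : OneCell X) → {x y : X} → (h : f.src = x := by simp) →
    (h' : f.tgt = y := by simp) → (x ⟶ y)
  | ⟨f⟩, _, _, rfl, rfl => f

@[simp] theorem mk_homOf (f : OneCell X) {x y : X} (h : f.src = x) (h' : f.tgt = y) :
    OneCell.mk (f.homOf h h') = f := by
  cases h; cases h'; rfl

@[simp] theorem id_src (x : X) : (id x).src = x := _root_.id rfl

@[simp] theorem id_tgt (x : X) : (id x).tgt = x := _root_.id rfl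

@[simp] theorem comp_src (f g : OneCell X) (h : f.tgt = g.src) : (f.comp g h).src = f.src := by
  obtain ⟨f⟩ := f; obtain ⟨g⟩ := g; cases h; rfl

@[simp] theorem comp_tgt (f g : OneCell X) (h : f.tgt = g.src) : (f.comp g h).tgt = g.tgt := by
  obtain ⟨f⟩ := f; obtain ⟨g⟩ := g; cases h; rfl

variable [Bicategory.Strict X]

@[simp] theorem id_comp (x : X) (f : OneCell X) (h : (id x).tgt = f.src) :
    (id x).comp f h = f := by
  obtain ⟨f⟩ := f; cases h; exact congrArg OneCell.mk (Bicategory.Strict.id_comp f)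

@[simp] theorem comp_id (f : OneCell X) (x : X) (h : f.tgt = (id x).src) :
    f.comp (id x) h = f := by
  obtain ⟨f⟩ := f; cases h; exact congrArg OneCell.mk (Bicategory.Strict.comp_id f)

@[simp] theorem comp_assoc (f g k : OneCell X) (h : f.tgt = g.src) (h' : (f.comp g h).tgt = k.src) :
    (f.comp g h).comp k h' =
      f.comp (g.comp k (by rw [← h', comp_tgt])) (by rw [comp_src, h]) := by
  obtain ⟨f⟩ := f; obtain ⟨g⟩ := g; cases h; obtain ⟨k⟩ := k; cases h'
  exact congrArg OneCell.mk (Bicategory.Strict.assoc f g k)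

end OneCell

namespace IsoCell

/-- The 1-cell at which an invertible 2-cell starts. -/
def dom (θ : IsoCell X) : OneCell X := ⟨θ.domHom⟩

/-- The 1-cell at which an invertible 2-cell ends. -/
def cod (θ : IsoCell X) : OneCell X := ⟨θ.codHom⟩

@[simp] theorem cod_src (θ : IsoCell X) : θ.cod.src = θ.dom.src := _root_.id rfl

@[simp] theorem cod_tgt (θ : IsoCell X) : θ.cod.tgt = θ.dom.tgt := _root_.id rfl

/-- The identity 2-cell of a 1-cell. -/
def refl (f : OneCell X) : IsoCell X := ⟨Iso.refl f.hom⟩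

/-- The inverse of an invertible 2-cell. -/
def symm (θ : IsoCell X) : IsoCell X := ⟨θ.iso.symm⟩

@[simp] theorem symm_dom (θ : IsoCell X) : θ.symm.dom = θ.cod := _root_.id rfl

@[simp] theorem symm_cod (θ : IsoCell X) : θ.symm.cod = θ.dom := _root_.id rfl

/-- Vertical composition: first `θ`, then `φ`. -/
def vcomp : (θ φ : IsoCell X) → (h : θ.cod = φ.dom := by simp [*]) → IsoCell X
  | ⟨θ⟩, ⟨φ⟩, rfl => ⟨θ ≪≫ φ⟩

/-- Precomposition of a 2-cell with a 1-cell: first `f`, then `θ`. -/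
def whiskerL : (f : OneCell X) → (θ : IsoCell X) → (h : f.tgt = θ.dom.src := by simp [*]) →
    IsoCell X
  | ⟨f⟩, ⟨θ⟩, rfl => ⟨whiskerLeftIso f θ⟩

/-- Postcomposition of a 2-cell with a 1-cell: first `θ`, then `f`. -/
def whiskerR : (θ : IsoCell X) → (f : OneCell X) → (h : θ.dom.tgt = f.src := by simp [*]) →
    IsoCell X
  | ⟨θ⟩, ⟨f⟩, rfl => ⟨whiskerRightIso θ f⟩

@[simp] theorem vcomp_dom (θ φ : IsoCell X) (h : θ.cod = φ.dom) :
    (θ.vcomp φ h).dom = θ.dom := by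
  obtain ⟨θ⟩ := θ; obtain ⟨φ⟩ := φ; cases h; rfl

@[simp] theorem vcomp_cod (θ φ : IsoCell X) (h : θ.cod = φ.dom) :
    (θ.vcomp φ h).cod = φ.cod := by
  obtain ⟨θ⟩ := θ; obtain ⟨φ⟩ := φ; cases h; rfl

@[simp] theorem whiskerL_dom (f : OneCell X) (θ : IsoCell X) (h : f.tgt = θ.dom.src) :
    (whiskerL f θ h).dom = f.comp θ.dom h := by
  obtain ⟨f⟩ := f; obtain ⟨θ⟩ := θ; cases h; rfl

@[simp] theorem whiskerL_cod (f : OneCell X) (θ : IsoCell X) (h : f.tgt = θ.dom.src) :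
    (whiskerL f θ h).cod = f.comp θ.cod h := by
  obtain ⟨f⟩ := f; obtain ⟨θ⟩ := θ; cases h; rfl

@[simp] theorem whiskerR_dom (θ : IsoCell X) (f : OneCell X) (h : θ.dom.tgt = f.src) :
    (θ.whiskerR f h).dom = θ.dom.comp f h := by
  obtain ⟨f⟩ := f; obtain ⟨θ⟩ := θ; cases h; rfl

@[simp] theorem whiskerR_cod (θ : IsoCell X) (f : OneCell X) (h : θ.dom.tgt = f.src) :
    (θ.whiskerR f h).cod = θ.cod.comp f h := by
  obtain ⟨f⟩ := f; obtain ⟨θ⟩ := θ; cases h; rfl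

end IsoCell

end Cells

/-! ### Cubical functors and Gray-categories -/

/-- A cubical functor `X × Y → Z` of 2-categories (equivalently, a 2-functor on the Gray tensor
product of `X` and `Y`): a function on objects, strictly 2-functorial in each variable, with an
invertible interchanger for each pair of 1-cells, natural in 2-cells and compatible with identities
and composition of 1-cells in each variable. -/
structure CubicalFunctor
    (X : Type*) (Y : Type*) (Z : Type*) [Bicategory X] [Bicategory Y] [Bicategory Z] where
  obj : X → Y → Z
  -- the 2-functors `obj - y`
  mapL {x x' : X} (f : x ⟶ x') (y : Y) : obj x y ⟶ obj x' y
  map₂L {x x' : X} {f f' : x ⟶ x'} (θ : f ⟶ f') (y : Y) : mapL f y ⟶ mapL f' y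
  mapL_id (x : X) (y : Y) : mapL (𝟙 x) y = 𝟙 (obj x y)
  mapL_comp {x x' x'' : X} (f : x ⟶ x') (f' : x' ⟶ x'') (y : Y) :
    mapL (f ≫ f') y = mapL f y ≫ mapL f' y
  map₂L_id {x x' : X} (f : x ⟶ x') (y : Y) : map₂L (𝟙 f) y = 𝟙 (mapL f y)
  map₂L_comp {x x' : X} {f f' f'' : x ⟶ x'} (θ : f ⟶ f') (θ' : f' ⟶ f'') (y : Y) :
    map₂L (θ ≫ θ') y = map₂L θ y ≫ map₂L θ' y
  map₂L_whiskerLeft {x x' x'' : X} (f : x ⟶ x') {k k' : x' ⟶ x''} (θ : k ⟶ k') (y : Y) :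
    TwoCell.mk (map₂L (f ◁ θ) y) = TwoCell.mk (mapL f y ◁ map₂L θ y)
  map₂L_whiskerRight {x x' x'' : X} {k k' : x ⟶ x'} (θ : k ⟶ k') (f : x' ⟶ x'') (y : Y) :
    TwoCell.mk (map₂L (θ ▷ f) y) = TwoCell.mk (map₂L θ y ▷ mapL f y)
  -- the 2-functors `obj x -`
  mapR (x : X) {y y' : Y} (g : y ⟶ y') : obj x y ⟶ obj x y'
  map₂R (x : X) {y y' : Y} {g g' : y ⟶ y'} (φ : g ⟶ g') : mapR x g ⟶ mapR x g'
  mapR_id (x : X) (y : Y) : mapR x (𝟙 y) = 𝟙 (obj x y)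
  mapR_comp (x : X) {y y' y'' : Y} (g : y ⟶ y') (g' : y' ⟶ y'') :
    mapR x (g ≫ g') = mapR x g ≫ mapR x g'
  map₂R_id (x : X) {y y' : Y} (g : y ⟶ y') : map₂R x (𝟙 g) = 𝟙 (mapR x g)
  map₂R_comp (x : X) {y y' : Y} {g g' g'' : y ⟶ y'} (φ : g ⟶ g') (φ' : g' ⟶ g'') :
    map₂R x (φ ≫ φ') = map₂R x φ ≫ map₂R x φ'
  map₂R_whiskerLeft (x : X) {y y' y'' : Y} (g : y ⟶ y') {k k' : y' ⟶ y''} (φ : k ⟶ k') :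
    TwoCell.mk (map₂R x (g ◁ φ)) = TwoCell.mk (mapR x g ◁ map₂R x φ)
  map₂R_whiskerRight (x : X) {y y' y'' : Y} {k k' : y ⟶ y'} (φ : k ⟶ k') (g : y' ⟶ y'') :
    TwoCell.mk (map₂R x (φ ▷ g)) = TwoCell.mk (map₂R x φ ▷ mapR x g)
  -- the interchanger
  swap {x x' : X} {y y' : Y} (f : x ⟶ x') (g : y ⟶ y') :
    mapL f y ≫ mapR x' g ≅ mapR x g ≫ mapL f y'
  swap_naturalL {x x' : X} {y y' : Y} {f f' : x ⟶ x'} (θ : f ⟶ f') (g : y ⟶ y') :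
    map₂L θ y ▷ mapR x' g ≫ (swap f' g).hom = (swap f g).hom ≫ mapR x g ◁ map₂L θ y'
  swap_naturalR {x x' : X} {y y' : Y} (f : x ⟶ x') {g g' : y ⟶ y'} (φ : g ⟶ g') :
    mapL f y ◁ map₂R x' φ ≫ (swap f g').hom = (swap f g).hom ≫ map₂R x φ ▷ mapL f y'
  swap_idL (x : X) {y y' : Y} (g : y ⟶ y') :
    TwoCell.mk (swap (𝟙 x) g).hom = TwoCell.mk (𝟙 (mapR x g))
  swap_idR {x x' : X} (f : x ⟶ x') (y : Y) :
    TwoCell.mk (swap f (𝟙 y)).hom = TwoCell.mk (𝟙 (mapL f y))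
  swap_compL {x x' x'' : X} {y y' : Y} (f : x ⟶ x') (f' : x' ⟶ x'') (g : y ⟶ y') :
    TwoCell.mk (swap (f ≫ f') g).hom =
      TwoCell.mk ((α_ (mapL f y) (mapL f' y) (mapR x'' g)).hom ≫
        mapL f y ◁ (swap f' g).hom ≫ (α_ (mapL f y) (mapR x' g) (mapL f' y')).inv ≫
        (swap f g).hom ▷ mapL f' y' ≫ (α_ (mapR x g) (mapL f y') (mapL f' y')).hom)
  swap_compR {x x' : X} {y y' y'' : Y} (f : x ⟶ x') (g : y ⟶ y') (g' : y' ⟶ y'') :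
    TwoCell.mk (swap f (g ≫ g')).hom =
      TwoCell.mk ((α_ (mapL f y) (mapR x' g) (mapR x' g')).inv ≫
        (swap f g).hom ▷ mapR x' g' ≫ (α_ (mapR x g) (mapL f y') (mapR x' g')).hom ≫
        mapR x g ◁ (swap f g').hom ≫ (α_ (mapR x g) (mapR x g') (mapL f y'')).inv)

/-- A Gray-category, i.e. a category enriched in the monoidal category of 2-categories with the
Gray tensor product: hom 2-categories `K(A,B)`, units, and composition cubical functors
`K(B,C) × K(A,B) → K(A,C)`, `(G, F) ↦ GF`, that are strictly associative and unital. Associativity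
is spelt out on objects, on 1-cells and 2-cells in each variable, and on the interchangers for each
pair of variables. -/
structure GrayCategory where
  Obj : Type u
  Hom : Obj → Obj → Type v
  [bicat : ∀ A B, Bicategory.{z, w} (Hom A B)]
  [strict : ∀ A B, Bicategory.Strict (Hom A B)]
  one (A : Obj) : Hom A A
  comp (A B C : Obj) : CubicalFunctor (Hom B C) (Hom A B) (Hom A C)
  -- units
  one_obj {A B : Obj} (F : Hom A B) : (comp A B B).obj (one B) F = F
  one_map {A B : Obj} {F F' : Hom A B} (f : F ⟶ F') :
    OneCell.mk ((comp A B B).mapR (one B) f) = OneCell.mk f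
  one_map₂ {A B : Obj} {F F' : Hom A B} {f f' : F ⟶ F'} (θ : f ⟶ f') :
    TwoCell.mk ((comp A B B).map₂R (one B) θ) = TwoCell.mk θ
  obj_one {A B : Obj} (F : Hom A B) : (comp A A B).obj F (one A) = F
  map_one {A B : Obj} {F F' : Hom A B} (f : F ⟶ F') :
    OneCell.mk ((comp A A B).mapL f (one A)) = OneCell.mk f
  map₂_one {A B : Obj} {F F' : Hom A B} {f f' : F ⟶ F'} (θ : f ⟶ f') :
    TwoCell.mk ((comp A A B).map₂L θ (one A)) = TwoCell.mk θ
  -- associativity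
  assoc_obj {A B C D : Obj} (H : Hom C D) (G : Hom B C) (F : Hom A B) :
    (comp A B D).obj ((comp B C D).obj H G) F = (comp A C D).obj H ((comp A B C).obj G F)
  assoc_left {A B C D : Obj} {H H' : Hom C D} (h : H ⟶ H') (G : Hom B C) (F : Hom A B) :
    OneCell.mk ((comp A B D).mapL ((comp B C D).mapL h G) F) =
      OneCell.mk ((comp A C D).mapL h ((comp A B C).obj G F))
  assoc_middle {A B C D : Obj} (H : Hom C D) {G G' : Hom B C} (g : G ⟶ G') (F : Hom A B) :
    OneCell.mk ((comp A B D).mapL ((comp B C D).mapR H g) F) =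
      OneCell.mk ((comp A C D).mapR H ((comp A B C).mapL g F))
  assoc_right {A B C D : Obj} (H : Hom C D) (G : Hom B C) {F F' : Hom A B} (f : F ⟶ F') :
    OneCell.mk ((comp A B D).mapR ((comp B C D).obj H G) f) =
      OneCell.mk ((comp A C D).mapR H ((comp A B C).mapR G f))
  assoc₂_left {A B C D : Obj} {H H' : Hom C D} {h h' : H ⟶ H'} (θ : h ⟶ h')
      (G : Hom B C) (F : Hom A B) :
    TwoCell.mk ((comp A B D).map₂L ((comp B C D).map₂L θ G) F) =
      TwoCell.mk ((comp A C D).map₂L θ ((comp A B C).obj G F))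
  assoc₂_middle {A B C D : Obj} (H : Hom C D) {G G' : Hom B C} {g g' : G ⟶ G'} (θ : g ⟶ g')
      (F : Hom A B) :
    TwoCell.mk ((comp A B D).map₂L ((comp B C D).map₂R H θ) F) =
      TwoCell.mk ((comp A C D).map₂R H ((comp A B C).map₂L θ F))
  assoc₂_right {A B C D : Obj} (H : Hom C D) (G : Hom B C) {F F' : Hom A B} {f f' : F ⟶ F'}
      (θ : f ⟶ f') :
    TwoCell.mk ((comp A B D).map₂R ((comp B C D).obj H G) θ) =
      TwoCell.mk ((comp A C D).map₂R H ((comp A B C).map₂R G θ))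
  swap_left_middle {A B C D : Obj} {H H' : Hom C D} (h : H ⟶ H') {G G' : Hom B C} (g : G ⟶ G')
      (F : Hom A B) :
    TwoCell.mk ((comp A B D).map₂L ((comp B C D).swap h g).hom F) =
      TwoCell.mk ((comp A C D).swap h ((comp A B C).mapL g F)).hom
  swap_left_right {A B C D : Obj} {H H' : Hom C D} (h : H ⟶ H') (G : Hom B C) {F F' : Hom A B}
      (f : F ⟶ F') :
    TwoCell.mk ((comp A B D).swap ((comp B C D).mapL h G) f).hom =
      TwoCell.mk ((comp A C D).swap h ((comp A B C).mapR G f)).hom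
  swap_middle_right {A B C D : Obj} (H : Hom C D) {G G' : Hom B C} (g : G ⟶ G') {F F' : Hom A B}
      (f : F ⟶ F') :
    TwoCell.mk ((comp A B D).swap ((comp B C D).mapR H g) f).hom =
      TwoCell.mk ((comp A C D).map₂R H ((comp A B C).swap g f).hom)

attribute [instance] GrayCategory.bicat GrayCategory.strict

namespace GrayCategory

variable {K : GrayCategory.{u, v, w, z}} {A B C D : K.Obj}

/-- The composite `GF` of morphisms. -/
def cmp (G : K.Hom B C) (F : K.Hom A B) : K.Hom A C := (K.comp A B C).obj G F

/-- The 2-morphism `Gf`. -/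
def lw (G : K.Hom B C) (f : OneCell (K.Hom A B)) : OneCell (K.Hom A C) :=
  ⟨(K.comp A B C).mapR G f.hom⟩

/-- The 2-morphism `gF`. -/
def rw (g : OneCell (K.Hom B C)) (F : K.Hom A B) : OneCell (K.Hom A C) :=
  ⟨(K.comp A B C).mapL g.hom F⟩

/-- The 3-isomorphism `Gθ`. -/
def lw₃ (G : K.Hom B C) (θ : IsoCell (K.Hom A B)) : IsoCell (K.Hom A C) where
  iso :=
    { hom := (K.comp A B C).map₂R G θ.iso.hom
      inv := (K.comp A B C).map₂R G θ.iso.inv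
      hom_inv_id := by
        rw [← CubicalFunctor.map₂R_comp, Iso.hom_inv_id, CubicalFunctor.map₂R_id]
      inv_hom_id := by
        rw [← CubicalFunctor.map₂R_comp, Iso.inv_hom_id, CubicalFunctor.map₂R_id] }

/-- The 3-isomorphism `θF`. -/
def rw₃ (θ : IsoCell (K.Hom B C)) (F : K.Hom A B) : IsoCell (K.Hom A C) where
  iso :=
    { hom := (K.comp A B C).map₂L θ.iso.hom F
      inv := (K.comp A B C).map₂L θ.iso.inv F
      hom_inv_id := by
        rw [← CubicalFunctor.map₂L_comp, Iso.hom_inv_id, CubicalFunctor.map₂L_id]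
      inv_hom_id := by
        rw [← CubicalFunctor.map₂L_comp, Iso.inv_hom_id, CubicalFunctor.map₂L_id] }

infixr:80 " ⊙ " => GrayCategory.cmp
infixr:80 " ⊙ₗ " => GrayCategory.lw
infixl:81 " ⊙ᵣ " => GrayCategory.rw
infixr:80 " ⊚ₗ " => GrayCategory.lw₃
infixl:81 " ⊚ᵣ " => GrayCategory.rw₃

/-- The Gray interchanger `g_f : G'f ∘ gF ≅ gF' ∘ Gf` for `f : F ⟶ F'` and `g : G ⟶ G'`. -/
def swap (g : OneCell (K.Hom B C)) (f : OneCell (K.Hom A B)) : IsoCell (K.Hom A C) :=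
  ⟨(K.comp A B C).swap g.hom f.hom⟩

@[simp] theorem one_cmp (F : K.Hom A B) : K.one B ⊙ F = F := K.one_obj F

@[simp] theorem cmp_one (F : K.Hom A B) : F ⊙ K.one A = F := K.obj_one F

@[simp] theorem cmp_assoc (H : K.Hom C D) (G : K.Hom B C) (F : K.Hom A B) :
    (H ⊙ G) ⊙ F = H ⊙ G ⊙ F := K.assoc_obj H G F

@[simp] theorem lw_src (G : K.Hom B C) (f : OneCell (K.Hom A B)) :
    (G ⊙ₗ f).src = G ⊙ f.src := _root_.id rfl

@[simp] theorem lw_tgt (G : K.Hom B C) (f : OneCell (K.Hom A B)) :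
    (G ⊙ₗ f).tgt = G ⊙ f.tgt := _root_.id rfl

@[simp] theorem rw_src (g : OneCell (K.Hom B C)) (F : K.Hom A B) :
    (g ⊙ᵣ F).src = g.src ⊙ F := _root_.id rfl

@[simp] theorem rw_tgt (g : OneCell (K.Hom B C)) (F : K.Hom A B) :
    (g ⊙ᵣ F).tgt = g.tgt ⊙ F := _root_.id rfl

@[simp] theorem one_lw (f : OneCell (K.Hom A B)) : K.one B ⊙ₗ f = f := K.one_map f.hom

@[simp] theorem rw_one (f : OneCell (K.Hom A B)) : f ⊙ᵣ K.one A = f := K.map_one f.hom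

@[simp] theorem lw_id (G : K.Hom B C) (F : K.Hom A B) :
    G ⊙ₗ OneCell.id F = OneCell.id (G ⊙ F) :=
  congrArg OneCell.mk ((K.comp A B C).mapR_id G F)

@[simp] theorem id_rw (G : K.Hom B C) (F : K.Hom A B) :
    OneCell.id G ⊙ᵣ F = OneCell.id (G ⊙ F) :=
  congrArg OneCell.mk ((K.comp A B C).mapL_id G F)

@[simp] theorem lw_comp (G : K.Hom B C) (f g : OneCell (K.Hom A B)) (h : f.tgt = g.src) :
    G ⊙ₗ f.comp g h = (G ⊙ₗ f).comp (G ⊙ₗ g) := by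
  obtain ⟨f⟩ := f; obtain ⟨g⟩ := g; cases h
  exact congrArg OneCell.mk ((K.comp A B C).mapR_comp G f g)

@[simp] theorem comp_rw (f g : OneCell (K.Hom B C)) (h : f.tgt = g.src) (F : K.Hom A B) :
    f.comp g h ⊙ᵣ F = (f ⊙ᵣ F).comp (g ⊙ᵣ F) := by
  obtain ⟨f⟩ := f; obtain ⟨g⟩ := g; cases h
  exact congrArg OneCell.mk ((K.comp A B C).mapL_comp f g F)

@[simp] theorem cmp_lw (H : K.Hom C D) (G : K.Hom B C) (f : OneCell (K.Hom A B)) :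
    (H ⊙ G) ⊙ₗ f = H ⊙ₗ G ⊙ₗ f := K.assoc_right H G f.hom

@[simp] theorem lw_rw (H : K.Hom C D) (g : OneCell (K.Hom B C)) (F : K.Hom A B) :
    (H ⊙ₗ g) ⊙ᵣ F = H ⊙ₗ (g ⊙ᵣ F) := K.assoc_middle H g.hom F

@[simp] theorem rw_rw (h : OneCell (K.Hom C D)) (G : K.Hom B C) (F : K.Hom A B) :
    h ⊙ᵣ G ⊙ᵣ F = h ⊙ᵣ (G ⊙ F) := K.assoc_left h.hom G F

@[simp] theorem lw₃_dom (G : K.Hom B C) (θ : IsoCell (K.Hom A B)) :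
    (G ⊚ₗ θ).dom = G ⊙ₗ θ.dom := _root_.id rfl

@[simp] theorem lw₃_cod (G : K.Hom B C) (θ : IsoCell (K.Hom A B)) :
    (G ⊚ₗ θ).cod = G ⊙ₗ θ.cod := _root_.id rfl

@[simp] theorem rw₃_dom (θ : IsoCell (K.Hom B C)) (F : K.Hom A B) :
    (θ ⊚ᵣ F).dom = θ.dom ⊙ᵣ F := _root_.id rfl

@[simp] theorem rw₃_cod (θ : IsoCell (K.Hom B C)) (F : K.Hom A B) :
    (θ ⊚ᵣ F).cod = θ.cod ⊙ᵣ F := _root_.id rfl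

@[simp] theorem swap_dom (g : OneCell (K.Hom B C)) (f : OneCell (K.Hom A B)) :
    (swap g f).dom = (g ⊙ᵣ f.src).comp (g.tgt ⊙ₗ f) := _root_.id rfl

@[simp] theorem swap_cod (g : OneCell (K.Hom B C)) (f : OneCell (K.Hom A B)) :
    (swap g f).cod = (g.src ⊙ₗ f).comp (g ⊙ᵣ f.tgt) := _root_.id rfl

end GrayCategory

open GrayCategory IsoCell

/-! ### Pseudoadjunctions -/

section Pseudo

variable {K : GrayCategory.{u, v, w, z}} {A B : K.Obj}

/-- A pseudoadjunction `I, E, i, e : F ⊣ₚ U : A → B` in a Gray-category. -/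
structure Pseudoadjunction (F : K.Hom B A) (U : K.Hom A B) where
  /-- the unit `1 ⟶ UF` -/
  i : K.one B ⟶ U ⊙ F
  /-- the counit `FU ⟶ 1` -/
  e : F ⊙ U ⟶ K.one A
  /-- `I : 1 ≅ Ue ∘ iU` -/
  I : IsoCell (K.Hom A B)
  I_dom : I.dom = OneCell.id U
  I_cod : I.cod = (⟨i⟩ ⊙ᵣ U).comp (U ⊙ₗ ⟨e⟩)
  /-- `E : eF ∘ Fi ≅ 1` -/
  E : IsoCell (K.Hom B A)
  E_dom : E.dom = (F ⊙ₗ ⟨i⟩).comp (⟨e⟩ ⊙ᵣ F)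
  E_cod : E.cod = OneCell.id F
  /-- The pasting `e ≅ e ∘ FUe ∘ FiU ≅ e ∘ eFU ∘ FiU ≅ e` of `FI`, `e_e⁻¹` and `EU` is the
  identity. -/
  counit_law :
    (((F ⊚ₗ I).whiskerR ⟨e⟩).vcomp
      (whiskerL (F ⊙ₗ (⟨i⟩ ⊙ᵣ U)) (swap ⟨e⟩ ⟨e⟩).symm)).vcomp
      ((E ⊚ᵣ U).whiskerR ⟨e⟩) = IsoCell.refl ⟨e⟩
  /-- The pasting `i ≅ UeF ∘ iUF ∘ i ≅ UeF ∘ UFi ∘ i ≅ i` of `IF`, `i_i⁻¹` and `UE` is the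
  identity. -/
  unit_law :
    ((whiskerL ⟨i⟩ (I ⊚ᵣ F)).vcomp
      ((swap ⟨i⟩ ⟨i⟩).symm.whiskerR (U ⊙ₗ (⟨e⟩ ⊙ᵣ F)))).vcomp
      (whiskerL ⟨i⟩ (U ⊚ₗ E)) = IsoCell.refl ⟨i⟩

/-- A pseudo ambijunction `F ⊣ₚ U ⊣ₚ F : A → B`. -/
structure PseudoAmbijunction (F : K.Hom B A) (U : K.Hom A B) where
  /-- `I, E, i, e : F ⊣ₚ U` -/
  left : Pseudoadjunction F U
  /-- `J, K, j, k : U ⊣ₚ F` -/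
  right : Pseudoadjunction U F

/-! ### Pseudomonads and Frobenius pseudomonads -/

/-- The data of a pseudomonad on `B`. -/
structure PseudomonadData (K : GrayCategory.{u, v, w, z}) (B : K.Obj) where
  T : K.Hom B B
  μ : T ⊙ T ⟶ T
  η : K.one B ⟶ T
  lam : IsoCell (K.Hom B B)
  rho : IsoCell (K.Hom B B)
  alpha : IsoCell (K.Hom B B)

/-- The data `(T, μ, η, λ, ρ, α)` form a pseudomonad. -/
structure PseudomonadData.IsPseudomonad (D : PseudomonadData K B) : Prop where
  /-- `λ : μ ∘ ηT ≅ 1` -/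
  lam_dom : D.lam.dom = (⟨D.η⟩ ⊙ᵣ D.T).comp ⟨D.μ⟩
  lam_cod : D.lam.cod = OneCell.id D.T
  /-- `ρ : 1 ≅ μ ∘ Tη` -/
  rho_dom : D.rho.dom = OneCell.id D.T
  rho_cod : D.rho.cod = (D.T ⊙ₗ ⟨D.η⟩).comp ⟨D.μ⟩
  /-- `α : μ ∘ Tμ ≅ μ ∘ μT` -/
  alpha_dom : D.alpha.dom = (D.T ⊙ₗ ⟨D.μ⟩).comp ⟨D.μ⟩
  alpha_cod : D.alpha.cod = (⟨D.μ⟩ ⊙ᵣ D.T).comp ⟨D.μ⟩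
  /-- The two pastings `μ ∘ Tμ ∘ TTμ ≅ μ ∘ μT ∘ μTT` agree: on the left that of `Tα`, `α` and `αT`,
  on the right that of `α`, `μ_μ⁻¹` and `α`. -/
  pentagon :
    (((D.T ⊚ₗ D.alpha).whiskerR ⟨D.μ⟩).vcomp
      (whiskerL (D.T ⊙ₗ (⟨D.μ⟩ ⊙ᵣ D.T)) D.alpha)).vcomp
      ((D.alpha ⊚ᵣ D.T).whiskerR ⟨D.μ⟩) =
    ((whiskerL (D.T ⊙ₗ D.T ⊙ₗ ⟨D.μ⟩) D.alpha).vcomp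
      ((swap ⟨D.μ⟩ ⟨D.μ⟩).symm.whiskerR ⟨D.μ⟩)).vcomp
      (whiskerL (⟨D.μ⟩ ⊙ᵣ (D.T ⊙ D.T)) D.alpha)
  /-- `α` precomposed with `TηT` is the composite `μ ∘ Tμ ∘ TηT ≅ μ ≅ μ ∘ μT ∘ TηT` of `Tλ` and
  `ρT`. -/
  unit_law :
    whiskerL (D.T ⊙ₗ (⟨D.η⟩ ⊙ᵣ D.T)) D.alpha =
    ((D.T ⊚ₗ D.lam).whiskerR ⟨D.μ⟩).vcomp ((D.rho ⊚ᵣ D.T).whiskerR ⟨D.μ⟩)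

/-- The data of a pseudomonad together with `ε : T ⟶ 1` form a Frobenius pseudomonad: a pseudomonad
such that `ε ∘ μ` is the counit of a pseudoadjunction `T ⊣ₚ T`. -/
def PseudomonadData.IsFrobeniusPseudomonad (D : PseudomonadData K B) (eps : D.T ⟶ K.one B) : Prop :=
  D.IsPseudomonad ∧ ∃ adj : Pseudoadjunction D.T D.T, adj.e = D.μ ≫ eps

/-- The (data of the) pseudomonad `(UF, UeF, i, (IF)⁻¹, (UE)⁻¹, U(e_e⁻¹)F)` induced by a
pseudoadjunction. -/
def Pseudoadjunction.induced {F : K.Hom B A} {U : K.Hom A B} (adj : Pseudoadjunction F U) :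
    PseudomonadData K B where
  T := U ⊙ F
  μ := (U ⊙ₗ (⟨adj.e⟩ ⊙ᵣ F)).homOf
  η := adj.i
  lam := (adj.I ⊚ᵣ F).symm
  rho := (U ⊚ₗ adj.E).symm
  alpha := U ⊚ₗ (swap ⟨adj.e⟩ ⟨adj.e⟩).symm ⊚ᵣ F

/-! ### Gray-monoids and Frobenius pseudomonoids -/

/-- A Gray-monoid (semistrict monoidal 2-category): a Gray-category with exactly one object. -/
structure GrayMonoid extends GrayCategory.{u, v, w, z} where
  [unique : Unique Obj]

attribute [instance] GrayMonoid.unique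

/-- For an object `B` of a Gray-category `K`, the 2-category `K(B,B)` with its Gray-monoid structure
given by composition in `K`. -/
def GrayCategory.endo (K : GrayCategory.{u, v, w, z}) (B : K.Obj) : GrayMonoid.{u, v, w, z} where
  Obj := PUnit
  Hom _ _ := K.Hom B B
  one _ := K.one B
  comp _ _ _ := K.comp B B B
  one_obj := K.one_obj
  one_map := K.one_map
  one_map₂ := K.one_map₂
  obj_one := K.obj_one
  map_one := K.map_one
  map₂_one := K.map₂_one
  assoc_obj := K.assoc_obj
  assoc_left := K.assoc_left
  assoc_middle := K.assoc_middle
  assoc_right := K.assoc_right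
  assoc₂_left := K.assoc₂_left
  assoc₂_middle := K.assoc₂_middle
  assoc₂_right := K.assoc₂_right
  swap_left_middle := K.swap_left_middle
  swap_left_right := K.swap_left_right
  swap_middle_right := K.swap_middle_right

/-- The data of a pseudomonoid in a Gray-monoid: an object `T`, multiplication, unit and coherence
2-cells, i.e. the data of a pseudomonad on the unique object. -/
abbrev PseudomonoidData (M : GrayMonoid.{u, v, w, z}) :=
  PseudomonadData M.toGrayCategory default

/-- A Frobenius pseudomonoid in a Gray-monoid is a Frobenius pseudomonad on its unique object. -/
def PseudomonoidData.IsFrobeniusPseudomonoid {M : GrayMonoid.{u, v, w, z}} (D : PseudomonoidData M)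
    (eps : D.T ⟶ M.one default) : Prop :=
  PseudomonadData.IsFrobeniusPseudomonad D eps

/-- The data of a pseudomonad on `B`, viewed as 1-cells and 2-cells of the Gray-monoid `K(B,B)`. -/
def PseudomonadData.toEndo (D : PseudomonadData K B) : PseudomonoidData (K.endo B) where
  T := D.T
  μ := D.μ
  η := D.η
  lam := D.lam
  rho := D.rho
  alpha := D.alpha

end Pseudo

end Gray

/-! The pseudomonad half is the counit law and one naturality square, transported along `U ⊚ₗ - ⊚ᵣ
F`. The pentagon is the image of `swap_yangBaxter`, which expresses naturality of $e_{(-)}$ at the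
3-cell $e_e$. The unit axiom is the image of the counit law of $F\dashv_p U$, solved for $e_e^{-1}$.

For the Frobenius half, compose $F\dashv_p U$ with $U\dashv_p F$. This makes $UF$ pseudoadjoint to
itself with counit $k\circ UeF=\varepsilon\circ\mu$ and unit $UjF\circ i$. Triangle isomorphisms are
easy to write down for the composite, whereas its two coherence laws would need large pastings. They
are avoided as follows: any unit and counit with invertible triangles can be made coherent by
altering only $E$ (`exists_counit_law`), after which the second law follows from the first
(`unit_law_of_counit_law`). The counit is unchanged, so `exists_pseudoadjunction` gives exactly what
is required.

All pastings are handled in the bundled type `IsoCell`, where strict associativity and unit laws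
become equations that `simp` uses to reach a normal form: vertical composites bracketed to the
right, with whiskerings pushed inside. -/

namespace Gray

/-! ### Calculus of invertible 2-cells in a strict 2-category. -/

section Cells

variable {X : Type v} [Bicategory.{z, w} X]

namespace IsoCell

/-- An inverse is determined by its 2-cell, so the Gray-category axioms, which are stated for
`TwoCell`s, yield equations of invertible cells. -/
theorem ext_hom {θ φ : IsoCell X} (h : TwoCell.mk θ.iso.hom = TwoCell.mk φ.iso.hom) : θ = φ := by
  obtain ⟨θ⟩ := θ
  obtain ⟨φ⟩ := φ
  injection h with h₁ h₂ h₃ h₄ h₅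
  subst h₁ h₂ h₃ h₄
  exact congrArg IsoCell.mk (Iso.ext (eq_of_heq h₅))

@[simp] theorem refl_dom (f : OneCell X) : (refl f).dom = f := _root_.id rfl

@[simp] theorem refl_cod (f : OneCell X) : (refl f).cod = f := _root_.id rfl

@[simp] theorem symm_symm (θ : IsoCell X) : θ.symm.symm = θ := _root_.id rfl

@[simp] theorem vcomp_assoc (θ φ ψ : IsoCell X) (h : θ.cod = φ.dom)
    (h' : (θ.vcomp φ h).cod = ψ.dom) :
    (θ.vcomp φ h).vcomp ψ h' =
      θ.vcomp (φ.vcomp ψ (by rw [← h', vcomp_cod])) (by rw [vcomp_dom, h]) := by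
  obtain ⟨θ⟩ := θ; obtain ⟨φ⟩ := φ; cases h; obtain ⟨ψ⟩ := ψ; cases h'
  exact congrArg IsoCell.mk (Iso.trans_assoc _ _ _)

@[simp] theorem refl_vcomp (f : OneCell X) (θ : IsoCell X) (h : (refl f).cod = θ.dom) :
    (refl f).vcomp θ h = θ := by
  obtain ⟨θ⟩ := θ; cases h
  exact congrArg IsoCell.mk (Iso.refl_trans _)

@[simp] theorem vcomp_refl (f : OneCell X) (θ : IsoCell X) (h : θ.cod = (refl f).dom) :
    θ.vcomp (refl f) h = θ := by
  obtain ⟨θ⟩ := θ; cases h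
  exact congrArg IsoCell.mk (Iso.trans_refl _)

@[simp] theorem vcomp_symm (θ : IsoCell X) (h : θ.cod = θ.symm.dom) :
    θ.vcomp θ.symm h = refl θ.dom :=
  congrArg IsoCell.mk (Iso.self_symm_id _)

@[simp] theorem symm_vcomp (θ : IsoCell X) (h : θ.symm.cod = θ.dom) :
    θ.symm.vcomp θ h = refl θ.cod :=
  congrArg IsoCell.mk (Iso.symm_self_id _)

@[simp] theorem symm_of_vcomp (θ φ : IsoCell X) (h : θ.cod = φ.dom) :
    (θ.vcomp φ h).symm = φ.symm.vcomp θ.symm (by rw [symm_cod, symm_dom, h]) := by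
  obtain ⟨θ⟩ := θ; obtain ⟨φ⟩ := φ; cases h; rfl

@[simp] theorem symm_whiskerL (f : OneCell X) (θ : IsoCell X) (h : f.tgt = θ.dom.src) :
    (whiskerL f θ h).symm = whiskerL f θ.symm (by rw [symm_dom, cod_src, h]) := by
  obtain ⟨f⟩ := f; obtain ⟨θ⟩ := θ; cases h; rfl

@[simp] theorem symm_whiskerR (f : OneCell X) (θ : IsoCell X) (h : θ.dom.tgt = f.src) :
    (whiskerR θ f h).symm = whiskerR θ.symm f (by rw [symm_dom, cod_tgt, h]) := by
  obtain ⟨f⟩ := f; obtain ⟨θ⟩ := θ; cases h; rfl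

@[simp] theorem symm_vcomp_vcomp (θ φ : IsoCell X) (h : θ.cod = φ.dom)
    (h' : θ.symm.cod = (θ.vcomp φ h).dom) : θ.symm.vcomp (θ.vcomp φ h) h' = φ := by
  obtain ⟨θ⟩ := θ; obtain ⟨φ⟩ := φ; cases h
  exact congrArg IsoCell.mk (Iso.symm_self_id_assoc _ _)

theorem vcomp_left_cancel {θ φ ψ : IsoCell X} {h : θ.cod = φ.dom} {h' : θ.cod = ψ.dom}
    (e : θ.vcomp φ h = θ.vcomp ψ h') : φ = ψ := by
  calc φ = θ.symm.vcomp (θ.vcomp φ h) (by simp) := (symm_vcomp_vcomp _ _ _ _).symm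
    _ = θ.symm.vcomp (θ.vcomp ψ h') (by simp) := by simp only [e]
    _ = ψ := symm_vcomp_vcomp _ _ _ _

theorem vcomp_right_cancel {θ φ ψ : IsoCell X} {h : φ.cod = θ.dom} {h' : ψ.cod = θ.dom}
    (e : φ.vcomp θ h = ψ.vcomp θ h') : φ = ψ := by
  have e' := congrArg symm e
  rw [symm_of_vcomp, symm_of_vcomp] at e'
  exact congrArg symm (vcomp_left_cancel e')

@[simp] theorem whiskerL_refl (f g : OneCell X) (h : f.tgt = (refl g).dom.src) :
    whiskerL f (refl g) h = refl (f.comp g h) := by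
  obtain ⟨f⟩ := f; obtain ⟨g⟩ := g; cases h
  exact congrArg IsoCell.mk (Iso.ext (whiskerLeft_id f g))

@[simp] theorem whiskerL_vcomp (f : OneCell X) (θ φ : IsoCell X) (h : θ.cod = φ.dom)
    (h' : f.tgt = (θ.vcomp φ h).dom.src) :
    whiskerL f (θ.vcomp φ h) h' =
      (whiskerL f θ (by rw [h', vcomp_dom])).vcomp
        (whiskerL f φ (by rw [h', vcomp_dom, ← h, cod_src])) (by simp [h]) := by
  obtain ⟨θ⟩ := θ; obtain ⟨φ⟩ := φ; cases h; obtain ⟨f⟩ := f; cases h'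
  exact congrArg IsoCell.mk (Iso.ext (Bicategory.whiskerLeft_comp _ _ _))

@[simp] theorem whiskerR_vcomp (f : OneCell X) (θ φ : IsoCell X) (h : θ.cod = φ.dom)
    (h' : (θ.vcomp φ h).dom.tgt = f.src) :
    whiskerR (θ.vcomp φ h) f h' =
      (whiskerR θ f (by rw [← h', vcomp_dom])).vcomp
        (whiskerR φ f (by rw [← h', vcomp_dom, ← h, cod_tgt])) (by simp [h]) := by
  obtain ⟨θ⟩ := θ; obtain ⟨φ⟩ := φ; cases h; obtain ⟨f⟩ := f; cases h'
  exact congrArg IsoCell.mk (Iso.ext (Bicategory.comp_whiskerRight _ _ _))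

/-- The interchange law of a 2-category. -/
theorem whisker_exchange (θ φ : IsoCell X) (h : θ.dom.tgt = φ.dom.src) :
    (θ.whiskerR φ.dom h).vcomp (whiskerL θ.cod φ (by rw [cod_tgt, h])) (by simp) =
      (whiskerL θ.dom φ h).vcomp (θ.whiskerR φ.cod (by rw [cod_src, h])) (by simp) := by
  obtain ⟨θ⟩ := θ; obtain ⟨φ⟩ := φ; cases h
  exact congrArg IsoCell.mk (Iso.ext (Bicategory.whisker_exchange _ _).symm)

variable [Bicategory.Strict X]

/-- In a strict bicategory the associators and unitors are `eqToHom`s. Bundling a cell with its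
boundary makes them disappear, which gives the strict whiskering laws below. -/
theorem twoCell_mk_eqToHom_comp {x y : X} {f f' g g' : x ⟶ y} (θ : f' ⟶ g) (p : f = f')
    (q : g = g') : TwoCell.mk (eqToHom p ≫ θ ≫ eqToHom q) = TwoCell.mk θ := by
  cases p; cases q; simp

/-- Unfolds a bundled composite whose middle boundaries agree only propositionally; needed to
compare with the `swap_compL` and `swap_compR` axioms. -/
theorem mk_vcomp_mk {x y : X} {f g g' k : x ⟶ y} (θ : f ≅ g) (φ : g' ≅ k) (p : g = g')
    (h : (IsoCell.mk θ).cod = (IsoCell.mk φ).dom) :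
    (IsoCell.mk θ).vcomp (IsoCell.mk φ) h = IsoCell.mk (θ ≪≫ eqToIso p ≪≫ φ) := by
  cases p; simp [vcomp]

@[simp] theorem whiskerL_id (x : X) (θ : IsoCell X) (h : (OneCell.id x).tgt = θ.dom.src) :
    whiskerL (OneCell.id x) θ h = θ := by
  obtain ⟨θ⟩ := θ; cases h
  apply ext_hom
  simp only [whiskerL, OneCell.id, whiskerLeftIso_hom, Bicategory.id_whiskerLeft,
    Bicategory.Strict.leftUnitor_eqToIso, eqToIso.hom, eqToIso.inv]
  exact twoCell_mk_eqToHom_comp _ _ _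

@[simp] theorem whiskerR_id (x : X) (θ : IsoCell X) (h : θ.dom.tgt = (OneCell.id x).src) :
    whiskerR θ (OneCell.id x) h = θ := by
  obtain ⟨θ⟩ := θ; cases h
  apply ext_hom
  simp only [whiskerR, OneCell.id, whiskerRightIso_hom, Bicategory.whiskerRight_id,
    Bicategory.Strict.rightUnitor_eqToIso, eqToIso.hom, eqToIso.inv]
  exact twoCell_mk_eqToHom_comp _ _ _

@[simp] theorem whiskerL_comp (f g : OneCell X) (θ : IsoCell X) (h : f.tgt = g.src)
    (h' : (f.comp g h).tgt = θ.dom.src) :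
    whiskerL (f.comp g h) θ h' =
      whiskerL f (whiskerL g θ (by rw [← h', OneCell.comp_tgt])) (by simp [h]) := by
  obtain ⟨f⟩ := f; obtain ⟨g⟩ := g; cases h; obtain ⟨θ⟩ := θ; cases h'
  apply ext_hom
  simp only [whiskerL, OneCell.comp, whiskerLeftIso_hom, Bicategory.comp_whiskerLeft,
    Bicategory.Strict.associator_eqToIso, eqToIso.hom, eqToIso.inv]
  exact twoCell_mk_eqToHom_comp _ _ _

@[simp] theorem whiskerR_comp (f g : OneCell X) (θ : IsoCell X) (h : f.tgt = g.src)
    (h' : θ.dom.tgt = (f.comp g h).src) :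
    whiskerR θ (f.comp g h) h' =
      whiskerR (whiskerR θ f (by rw [h', OneCell.comp_src])) g (by simp [h]) := by
  obtain ⟨f⟩ := f; obtain ⟨g⟩ := g; cases h; obtain ⟨θ⟩ := θ; cases h'
  apply ext_hom
  simp only [whiskerR, OneCell.comp, whiskerRightIso_hom, Bicategory.whiskerRight_comp,
    Bicategory.Strict.associator_eqToIso, eqToIso.hom, eqToIso.inv]
  exact twoCell_mk_eqToHom_comp _ _ _

@[simp] theorem whisker_assoc (f g : OneCell X) (θ : IsoCell X) (h : f.tgt = θ.dom.src)
    (h' : (whiskerL f θ h).dom.tgt = g.src) :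
    whiskerR (whiskerL f θ h) g h' =
      whiskerL f (whiskerR θ g (by rw [← h']; simp)) (by simp [h]) := by
  obtain ⟨f⟩ := f; obtain ⟨θ⟩ := θ; cases h; obtain ⟨g⟩ := g; cases h'
  apply ext_hom
  simp only [whiskerL, whiskerR, whiskerRightIso_hom, whiskerLeftIso_hom,
    Bicategory.whisker_assoc, Bicategory.Strict.associator_eqToIso, eqToIso.hom, eqToIso.inv]
  exact twoCell_mk_eqToHom_comp _ _ _

end IsoCell

end Cells

open IsoCell

/-! ### Whiskering 3-isomorphisms by morphisms, and the laws of the interchanger. -/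

namespace GrayCategory

variable {K : GrayCategory.{u, v, w, z}} {A B C D : K.Obj}

@[simp] theorem lw₃_symm (G : K.Hom B C) (θ : IsoCell (K.Hom A B)) :
    G ⊚ₗ θ.symm = (G ⊚ₗ θ).symm := _root_.id rfl

@[simp] theorem rw₃_symm (θ : IsoCell (K.Hom B C)) (F : K.Hom A B) :
    θ.symm ⊚ᵣ F = (θ ⊚ᵣ F).symm := _root_.id rfl

@[simp] theorem lw₃_refl (G : K.Hom B C) (f : OneCell (K.Hom A B)) :
    G ⊚ₗ refl f = refl (G ⊙ₗ f) :=
  congrArg IsoCell.mk (Iso.ext ((K.comp A B C).map₂R_id G f.hom))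

@[simp] theorem rw₃_refl (g : OneCell (K.Hom B C)) (F : K.Hom A B) :
    refl g ⊚ᵣ F = refl (g ⊙ᵣ F) :=
  congrArg IsoCell.mk (Iso.ext ((K.comp A B C).map₂L_id g.hom F))

@[simp] theorem lw₃_vcomp (G : K.Hom B C) (θ φ : IsoCell (K.Hom A B)) (h : θ.cod = φ.dom) :
    G ⊚ₗ θ.vcomp φ h = (G ⊚ₗ θ).vcomp (G ⊚ₗ φ) (by simp [h]) := by
  obtain ⟨θ⟩ := θ; obtain ⟨φ⟩ := φ; cases h
  exact congrArg IsoCell.mk (Iso.ext ((K.comp A B C).map₂R_comp G θ.hom φ.hom))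

@[simp] theorem rw₃_vcomp (θ φ : IsoCell (K.Hom B C)) (h : θ.cod = φ.dom) (F : K.Hom A B) :
    θ.vcomp φ h ⊚ᵣ F = (θ ⊚ᵣ F).vcomp (φ ⊚ᵣ F) (by simp [h]) := by
  obtain ⟨θ⟩ := θ; obtain ⟨φ⟩ := φ; cases h
  exact congrArg IsoCell.mk (Iso.ext ((K.comp A B C).map₂L_comp θ.hom φ.hom F))

@[simp] theorem lw₃_whiskerL (G : K.Hom B C) (f : OneCell (K.Hom A B)) (θ : IsoCell (K.Hom A B))
    (h : f.tgt = θ.dom.src) :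
    G ⊚ₗ whiskerL f θ h = whiskerL (G ⊙ₗ f) (G ⊚ₗ θ) (by simp [h]) := by
  obtain ⟨f⟩ := f; obtain ⟨θ⟩ := θ; cases h
  exact ext_hom ((K.comp A B C).map₂R_whiskerLeft G f θ.hom)

@[simp] theorem lw₃_whiskerR (G : K.Hom B C) (f : OneCell (K.Hom A B)) (θ : IsoCell (K.Hom A B))
    (h : θ.dom.tgt = f.src) :
    G ⊚ₗ whiskerR θ f h = whiskerR (G ⊚ₗ θ) (G ⊙ₗ f) (by simp [h]) := by
  obtain ⟨f⟩ := f; obtain ⟨θ⟩ := θ; cases h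
  exact ext_hom ((K.comp A B C).map₂R_whiskerRight G θ.hom f)

@[simp] theorem rw₃_whiskerL (F : K.Hom A B) (f : OneCell (K.Hom B C)) (θ : IsoCell (K.Hom B C))
    (h : f.tgt = θ.dom.src) :
    whiskerL f θ h ⊚ᵣ F = whiskerL (f ⊙ᵣ F) (θ ⊚ᵣ F) (by simp [h]) := by
  obtain ⟨f⟩ := f; obtain ⟨θ⟩ := θ; cases h
  exact ext_hom ((K.comp A B C).map₂L_whiskerLeft f θ.hom F)

@[simp] theorem rw₃_whiskerR (F : K.Hom A B) (f : OneCell (K.Hom B C)) (θ : IsoCell (K.Hom B C))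
    (h : θ.dom.tgt = f.src) :
    whiskerR θ f h ⊚ᵣ F = whiskerR (θ ⊚ᵣ F) (f ⊙ᵣ F) (by simp [h]) := by
  obtain ⟨f⟩ := f; obtain ⟨θ⟩ := θ; cases h
  exact ext_hom ((K.comp A B C).map₂L_whiskerRight θ.hom f F)

@[simp] theorem one_lw₃ (θ : IsoCell (K.Hom A B)) : K.one B ⊚ₗ θ = θ :=
  ext_hom (K.one_map₂ θ.iso.hom)

@[simp] theorem rw₃_one (θ : IsoCell (K.Hom A B)) : θ ⊚ᵣ K.one A = θ :=
  ext_hom (K.map₂_one θ.iso.hom)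

@[simp] theorem cmp_lw₃ (H : K.Hom C D) (G : K.Hom B C) (θ : IsoCell (K.Hom A B)) :
    (H ⊙ G) ⊚ₗ θ = H ⊚ₗ G ⊚ₗ θ := ext_hom (K.assoc₂_right H G θ.iso.hom)

@[simp] theorem lw₃_rw₃ (H : K.Hom C D) (θ : IsoCell (K.Hom B C)) (F : K.Hom A B) :
    (H ⊚ₗ θ) ⊚ᵣ F = H ⊚ₗ (θ ⊚ᵣ F) := ext_hom (K.assoc₂_middle H θ.iso.hom F)

@[simp] theorem rw₃_rw₃ (θ : IsoCell (K.Hom C D)) (G : K.Hom B C) (F : K.Hom A B) :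
    θ ⊚ᵣ G ⊚ᵣ F = θ ⊚ᵣ (G ⊙ F) := ext_hom (K.assoc₂_left θ.iso.hom G F)

@[simp] theorem swap_rw₃ (h : OneCell (K.Hom C D)) (g : OneCell (K.Hom B C)) (F : K.Hom A B) :
    swap h g ⊚ᵣ F = swap h (g ⊙ᵣ F) := ext_hom (K.swap_left_middle h.hom g.hom F)

@[simp] theorem swap_rw (h : OneCell (K.Hom C D)) (G : K.Hom B C) (f : OneCell (K.Hom A B)) :
    swap (h ⊙ᵣ G) f = swap h (G ⊙ₗ f) := ext_hom (K.swap_left_right h.hom G f.hom)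

@[simp] theorem swap_lw (H : K.Hom C D) (g : OneCell (K.Hom B C)) (f : OneCell (K.Hom A B)) :
    swap (H ⊙ₗ g) f = H ⊚ₗ swap g f := ext_hom (K.swap_middle_right H g.hom f.hom)

@[simp] theorem swap_id_left (G : K.Hom B C) (f : OneCell (K.Hom A B)) :
    swap (OneCell.id G) f = refl (G ⊙ₗ f) :=
  ext_hom ((K.comp A B C).swap_idL G f.hom)

@[simp] theorem swap_id_right (g : OneCell (K.Hom B C)) (F : K.Hom A B) :
    swap g (OneCell.id F) = refl (g ⊙ᵣ F) :=
  ext_hom ((K.comp A B C).swap_idR g.hom F)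

theorem swap_natural_left (θ : IsoCell (K.Hom B C)) (f : OneCell (K.Hom A B)) :
    (whiskerR (θ ⊚ᵣ f.src) (θ.dom.tgt ⊙ₗ f)).vcomp (swap θ.cod f) =
      (swap θ.dom f).vcomp (whiskerL (θ.dom.src ⊙ₗ f) (θ ⊚ᵣ f.tgt)) :=
  congrArg IsoCell.mk (Iso.ext ((K.comp A B C).swap_naturalL θ.iso.hom f.hom))

theorem swap_natural_right (g : OneCell (K.Hom B C)) (θ : IsoCell (K.Hom A B)) :
    (whiskerL (g ⊙ᵣ θ.dom.src) (g.tgt ⊚ₗ θ)).vcomp (swap g θ.cod) =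
      (swap g θ.dom).vcomp (whiskerR (g.src ⊚ₗ θ) (g ⊙ᵣ θ.dom.tgt)) :=
  congrArg IsoCell.mk (Iso.ext ((K.comp A B C).swap_naturalR g.hom θ.iso.hom))

theorem swap_comp_left (f g : OneCell (K.Hom B C)) (h : f.tgt = g.src) (k : OneCell (K.Hom A B)) :
    swap (f.comp g h) k =
      (whiskerL (f ⊙ᵣ k.src) (swap g k)).vcomp (whiskerR (swap f k) (g ⊙ᵣ k.tgt)) := by
  obtain ⟨f⟩ := f; obtain ⟨g⟩ := g; obtain ⟨k⟩ := k; cases h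
  apply ext_hom
  refine ((K.comp A B C).swap_compL f g k).trans (Eq.trans ?_
    (congrArg (fun θ : IsoCell (K.Hom A C) => TwoCell.mk θ.iso.hom)
      (mk_vcomp_mk (whiskerLeftIso ((K.comp A B C).mapL f _) ((K.comp A B C).swap g k))
        (whiskerRightIso ((K.comp A B C).swap f k) ((K.comp A B C).mapL g _))
        (Bicategory.Strict.assoc _ _ _).symm
        (congrArg OneCell.mk (Bicategory.Strict.assoc _ _ _).symm)).symm))
  -- The middle associator of the axiom is the `eqToIso` inserted by `mk_vcomp_mk`; the two outer
  -- ones are absorbed by bundling.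
  simp only [Bicategory.Strict.associator_eqToIso, eqToIso.hom, eqToIso.inv, Iso.trans_hom,
    whiskerLeftIso_hom, whiskerRightIso_hom]
  simpa only [Category.assoc] using twoCell_mk_eqToHom_comp (_ ≫ _ ≫ _) _ _

theorem swap_comp_right (g : OneCell (K.Hom B C)) (f k : OneCell (K.Hom A B)) (h : f.tgt = k.src) :
    swap g (f.comp k h) =
      (whiskerR (swap g f) (g.tgt ⊙ₗ k)).vcomp (whiskerL (g.src ⊙ₗ f) (swap g k)) := by
  obtain ⟨f⟩ := f; obtain ⟨g⟩ := g; obtain ⟨k⟩ := k; cases h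
  apply ext_hom
  refine ((K.comp A B C).swap_compR g f k).trans (Eq.trans ?_
    (congrArg (fun θ : IsoCell (K.Hom A C) => TwoCell.mk θ.iso.hom)
      (mk_vcomp_mk (whiskerRightIso ((K.comp A B C).swap g f) ((K.comp A B C).mapR _ k))
        (whiskerLeftIso ((K.comp A B C).mapR _ f) ((K.comp A B C).swap g k))
        (Bicategory.Strict.assoc _ _ _)
        (congrArg OneCell.mk (Bicategory.Strict.assoc _ _ _))).symm))
  simp only [Bicategory.Strict.associator_eqToIso, eqToIso.hom, eqToIso.inv, Iso.trans_hom,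
    whiskerLeftIso_hom, whiskerRightIso_hom]
  simpa only [Category.assoc] using twoCell_mk_eqToHom_comp (_ ≫ _ ≫ _) _ _

end GrayCategory

open GrayCategory

/-! ### Solving and rewriting equations between pastings. -/

namespace IsoCell

variable {X : Type v} [Bicategory.{z, w} X]

theorem eq_symm_vcomp {θ φ ψ : IsoCell X} {h : θ.cod = φ.dom} (e : θ.vcomp φ h = ψ) :
    φ = θ.symm.vcomp ψ (by rw [← e, vcomp_dom, symm_cod]) := by
  subst e; simp

theorem eq_vcomp_symm {θ φ ψ : IsoCell X} {h : φ.cod = θ.dom} (e : φ.vcomp θ h = ψ) :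
    φ = ψ.vcomp θ.symm (by rw [← e, vcomp_cod, symm_dom]) := by
  subst e; simp

/-- With composites bracketed to the right, an equation for $\theta$ followed by $\varphi$ applies
inside a longer pasting only after a tail `χ` is added. -/
theorem vcomp_reassoc {θ φ ψ : IsoCell X} {h : θ.cod = φ.dom} (e : θ.vcomp φ h = ψ)
    (χ : IsoCell X) (h₁ : φ.cod = χ.dom) (h₂ : θ.cod = (φ.vcomp χ h₁).dom) :
    θ.vcomp (φ.vcomp χ h₁) h₂ = ψ.vcomp χ (by rw [← e, vcomp_cod, h₁]) := by
  subst e; simp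

theorem vcomp_reassoc₃ {θ φ ψ ω : IsoCell X} {h : φ.cod = ψ.dom} {h' : θ.cod = (φ.vcomp ψ h).dom}
    (e : θ.vcomp (φ.vcomp ψ h) h' = ω) (χ : IsoCell X) (h₁ : ψ.cod = χ.dom)
    (h₂ : φ.cod = (ψ.vcomp χ h₁).dom) (h₃ : θ.cod = (φ.vcomp (ψ.vcomp χ h₁) h₂).dom) :
    θ.vcomp (φ.vcomp (ψ.vcomp χ h₁) h₂) h₃ = ω.vcomp χ (by rw [← e]; simp [h₁]) := by
  subst e; simp

theorem whiskerL_congr (f : OneCell X) {θ φ : IsoCell X} (e : θ = φ) (h : f.tgt = θ.dom.src) :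
    whiskerL f θ h = whiskerL f φ (by rw [h, e]) := by
  subst e; rfl

theorem whiskerR_congr (f : OneCell X) {θ φ : IsoCell X} (e : θ = φ) (h : θ.dom.tgt = f.src) :
    whiskerR θ f h = whiskerR φ f (by rw [← h, e]) := by
  subst e; rfl

end IsoCell

/-! ### The pseudomonad induced by a pseudoadjunction. -/

section Pseudo

variable {K : GrayCategory.{u, v, w, z}} {A B : K.Obj}

/-- Naturality of the interchanger `e_{(-)}` with respect to the interchanger `e_e`. -/
theorem swap_yangBaxter {G : K.Hom A A} (e : G ⟶ K.one A) :
    (((G ⊚ₗ (swap ⟨e⟩ ⟨e⟩).symm).whiskerR ⟨e⟩).vcomp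
      (whiskerL (G ⊙ₗ (⟨e⟩ ⊙ᵣ G)) (swap ⟨e⟩ ⟨e⟩).symm)).vcomp
      (((swap ⟨e⟩ ⟨e⟩).symm ⊚ᵣ G).whiskerR ⟨e⟩) =
    ((whiskerL (G ⊙ₗ G ⊙ₗ ⟨e⟩) (swap ⟨e⟩ ⟨e⟩).symm).vcomp
      ((swap ⟨e⟩ (G ⊙ₗ ⟨e⟩)).symm.whiskerR ⟨e⟩)).vcomp
      (whiskerL (⟨e⟩ ⊙ᵣ (G ⊙ G)) (swap ⟨e⟩ ⟨e⟩).symm) := by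
  -- Both boundaries of $e_e$ are composites, so `swap_comp_right` splits each outer interchanger
  -- into two. Inverting yields the direction in which $e_e^{-1}$ occurs.
  have h := congrArg IsoCell.symm (swap_natural_right ⟨e⟩ (swap ⟨e⟩ ⟨e⟩))
  simp [swap_comp_right] at h
  simp [h]

theorem Pseudoadjunction.induced_isPseudomonad {F : K.Hom B A} {U : K.Hom A B}
    (adj : Pseudoadjunction F U) : adj.induced.IsPseudomonad where
  lam_dom := by simp [induced, adj.I_cod]
  lam_cod := by simp [induced, adj.I_dom]
  rho_dom := by simp [induced, adj.E_cod]
  rho_cod := by simp [induced, adj.E_dom]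
  alpha_dom := by simp [induced]
  alpha_cod := by simp [induced]
  pentagon := by
    have h := congrArg (fun θ => U ⊚ₗ θ ⊚ᵣ F) (swap_yangBaxter adj.e)
    simp [induced] at h ⊢
    exact h
  unit_law := by
    have h := congrArg (fun θ => U ⊚ₗ θ ⊚ᵣ F) adj.counit_law
    simp [induced] at h ⊢
    -- Moving $FI$ and $EU$ to the other side isolates $e_e^{-1}$. Their inverses are what $\lambda$
    -- and $\rho$ are built from.
    have h' := eq_vcomp_symm (eq_symm_vcomp h)
    simp at h'
    exact h'

/-! ### Making a pseudoadjunction coherent. -/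

/-- The counit law can be achieved by changing `E` only. -/
theorem exists_counit_law {F : K.Hom B A} {U : K.Hom A B} (i : K.one B ⟶ U ⊙ F)
    (e : F ⊙ U ⟶ K.one A) (I : IsoCell (K.Hom A B)) (I_dom : I.dom = OneCell.id U)
    (I_cod : I.cod = (⟨i⟩ ⊙ᵣ U).comp (U ⊙ₗ ⟨e⟩)) (E : IsoCell (K.Hom B A))
    (E_dom : E.dom = (F ⊙ₗ ⟨i⟩).comp (⟨e⟩ ⊙ᵣ F)) (E_cod : E.cod = OneCell.id F) :
    ∃ (E' : IsoCell (K.Hom B A)) (E'_dom : E'.dom = (F ⊙ₗ ⟨i⟩).comp (⟨e⟩ ⊙ᵣ F))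
      (_ : E'.cod = OneCell.id F),
      (((F ⊚ₗ I).whiskerR ⟨e⟩).vcomp
        (whiskerL (F ⊙ₗ (⟨i⟩ ⊙ᵣ U)) (swap ⟨e⟩ ⟨e⟩).symm)).vcomp
        ((E' ⊚ᵣ U).whiskerR ⟨e⟩) = IsoCell.refl ⟨e⟩ := by
  obtain ⟨L, hL⟩ : ∃ L, (((F ⊚ₗ I).whiskerR ⟨e⟩).vcomp
        (whiskerL (F ⊙ₗ (⟨i⟩ ⊙ᵣ U)) (swap ⟨e⟩ ⟨e⟩).symm)).vcomp
        ((E ⊚ᵣ U).whiskerR ⟨e⟩) = L := ⟨_, rfl⟩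
  have L_dom : L.dom = ⟨e⟩ := by simp [← hL, I_dom]
  have L_cod : L.cod = ⟨e⟩ := by simp [← hL, E_cod]
  -- The pasting `L` is an automorphism of $e$ measuring the failure of the law, so `E` is corrected
  -- by $L^{-1}F\circ Fi$.
  refine ⟨(whiskerL (F ⊙ₗ ⟨i⟩) (L.symm ⊚ᵣ F)).vcomp E, by simp [L_cod], by simp [E_cod], ?_⟩
  -- The correction slides back past $e_e^{-1}$ by naturality (`nat`) and past $FI$ by interchange
  -- (`exch`). It then stands in front of the original pasting, and $L^{-1}$ followed by `L` is the
  -- identity.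
  have nat := whiskerL_congr (F ⊙ₗ (⟨i⟩ ⊙ᵣ U)) (congrArg IsoCell.symm (swap_natural_left L ⟨e⟩))
    (by simp [L_dom])
  have exch := whisker_exchange (F ⊚ₗ I) L.symm (by simp [*])
  simp [L_dom, L_cod, I_dom, I_cod] at nat exch hL ⊢
  simp [vcomp_reassoc nat, vcomp_reassoc exch, hL, L_cod]

/-- The counit law of a pseudoadjunction implies the unit law. -/
theorem unit_law_of_counit_law {F : K.Hom B A} {U : K.Hom A B} (i : K.one B ⟶ U ⊙ F)
    (e : F ⊙ U ⟶ K.one A) (I : IsoCell (K.Hom A B)) (I_dom : I.dom = OneCell.id U)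
    (I_cod : I.cod = (⟨i⟩ ⊙ᵣ U).comp (U ⊙ₗ ⟨e⟩)) (E : IsoCell (K.Hom B A))
    (E_dom : E.dom = (F ⊙ₗ ⟨i⟩).comp (⟨e⟩ ⊙ᵣ F)) (E_cod : E.cod = OneCell.id F)
    (counit_law : (((F ⊚ₗ I).whiskerR ⟨e⟩).vcomp
        (whiskerL (F ⊙ₗ (⟨i⟩ ⊙ᵣ U)) (swap ⟨e⟩ ⟨e⟩).symm)).vcomp
        ((E ⊚ᵣ U).whiskerR ⟨e⟩) = IsoCell.refl ⟨e⟩) :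
    ((whiskerL ⟨i⟩ (I ⊚ᵣ F)).vcomp
      ((swap ⟨i⟩ ⟨i⟩).symm.whiskerR (U ⊙ₗ (⟨e⟩ ⊙ᵣ F)))).vcomp
      (whiskerL ⟨i⟩ (U ⊚ₗ E)) = IsoCell.refl ⟨i⟩ := by
  obtain ⟨M, hM⟩ : ∃ M, ((whiskerL ⟨i⟩ (I ⊚ᵣ F)).vcomp
      ((swap ⟨i⟩ ⟨i⟩).symm.whiskerR (U ⊙ₗ (⟨e⟩ ⊙ᵣ F)))).vcomp
      (whiskerL ⟨i⟩ (U ⊚ₗ E)) = M := ⟨_, rfl⟩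
  have M_dom : M.dom = ⟨i⟩ := by simp [← hM, I_dom]
  have M_cod : M.cod = ⟨i⟩ := by simp [← hM, E_cod]
  rw [hM]
  -- The automorphism `M` of $i$ is first shown to be trivial after whiskering to $Ue\circ MU$,
  -- where the counit law can be used.
  have hMU : whiskerR (M ⊚ᵣ U) (U ⊙ₗ ⟨e⟩) (by simp [M_dom]) =
      IsoCell.refl ((⟨i⟩ ⊙ᵣ U).comp (U ⊙ₗ ⟨e⟩)) := by
    have h₁ := congrArg (fun θ => U ⊚ₗ θ) counit_law
    have h₂ := swap_natural_right ⟨i⟩ I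
    have h₃ := swap_natural_left I ⟨e⟩
    simp [I_dom, I_cod, swap_comp_left, swap_comp_right] at h₁ h₂ h₃
    -- The counit law under $U$ replaces $Ue\circ UEU$ by $Ue_e$ followed by the inverse of a
    -- whiskering of $UFI$. The interchangers are then removed using interchange and naturality at
    -- $I$, on the $i$ side (`h₂`) and on the $e$ side (`h₃`).
    have h₄ := whiskerL_congr (⟨i⟩ ⊙ᵣ U)
      (eq_symm_vcomp (eq_symm_vcomp h₁)) (by simp [E_dom])
    have h₂' := congrArg IsoCell.symm h₂
    simp at h₂'
    have h₅ := whiskerR_congr (U ⊙ₗ ⟨e⟩)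
      (eq_symm_vcomp h₂') (by simp)
    have h₆ := whiskerL_congr (⟨i⟩ ⊙ᵣ U) h₃ (by simp [I_dom])
    have exch := whisker_exchange (swap ⟨i⟩ (⟨i⟩ ⊙ᵣ U)).symm (U ⊚ₗ swap ⟨e⟩ ⟨e⟩) (by simp)
    have hI := whisker_exchange I I (by simp [*])
    simp [I_dom, I_cod] at h₄ h₅ h₆ exch hI
    have inv := vcomp_symm ((I.whiskerR (⟨i⟩ ⊙ᵣ U) (by simp [*])).whiskerR (U ⊙ₗ ⟨e⟩) (by simp [*]))
      rfl
    simp [-vcomp_symm, I_dom] at inv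
    -- Interchanging $I$ with itself and cancelling one copy shows that its two whiskerings by
    -- $Ue\circ iU$ coincide. What remains of the pasting is one of them followed by the inverse of
    -- the other.
    have hI' := vcomp_left_cancel hI
    simp [← hM]
    simp [h₄, vcomp_reassoc exch, h₅, vcomp_reassoc₃ h₆, hI', inv]
  -- Naturality of $i_i$ in `M` trades `M` followed by $UFi$ for $i$ followed by $MUF$. Once
  -- whiskered with $UeF$, the latter is trivial by `hMU`, so `M` is trivial after whiskering with
  -- $UeF\circ UFi$.
  have nat := whiskerR_congr (U ⊙ₗ (⟨e⟩ ⊙ᵣ F)) (swap_natural_left M ⟨i⟩) (by simp [M_dom])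
  have hMF := whiskerL_congr ⟨i⟩ (congrArg (fun θ => θ ⊚ᵣ F) hMU) (by simp [M_dom])
  have exch := whisker_exchange M (U ⊚ₗ E) (by simp [*])
  simp [M_dom, M_cod, E_dom, E_cod] at nat exch hMF
  simp [hMF] at nat
  have hM' := vcomp_right_cancel (nat.trans (refl_vcomp _ _ (refl_cod _)).symm)
  simp [hM'] at exch
  -- Interchange with the invertible $UE\colon UeF\circ UFi\to 1$ strips off that whiskering.
  exact vcomp_left_cancel (exch.symm.trans (vcomp_refl _ _ (by simp [E_cod])).symm)

/-- A 2-adjunction up to unspecified isomorphism underlies a pseudoadjunction with the same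
counit. -/
theorem exists_pseudoadjunction {F : K.Hom B A} {U : K.Hom A B} (i : K.one B ⟶ U ⊙ F)
    (e : F ⊙ U ⟶ K.one A) (I : IsoCell (K.Hom A B)) (I_dom : I.dom = OneCell.id U)
    (I_cod : I.cod = (⟨i⟩ ⊙ᵣ U).comp (U ⊙ₗ ⟨e⟩)) (E : IsoCell (K.Hom B A))
    (E_dom : E.dom = (F ⊙ₗ ⟨i⟩).comp (⟨e⟩ ⊙ᵣ F)) (E_cod : E.cod = OneCell.id F) :
    ∃ adj : Pseudoadjunction F U, adj.e = e := by
  obtain ⟨E', E'_dom, E'_cod, h⟩ := exists_counit_law i e I I_dom I_cod E E_dom E_cod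
  exact ⟨⟨i, e, I, I_dom, I_cod, E', E'_dom, E'_cod, h,
    unit_law_of_counit_law i e I I_dom I_cod E' E'_dom E'_cod h⟩, rfl⟩

/-! ### The composite self-adjunction of $UF$. -/

theorem mk_comp_eq {X : Type v} [Bicategory.{z, w} X] {x y t : X} (f : x ⟶ y) (g : y ⟶ t) :
    OneCell.mk (f ≫ g) = (OneCell.mk f).comp (OneCell.mk g) rfl := rfl

/-- Pseudoadjunctions compose: $F\dashv_p U$ and $U\dashv_p F$ give $UF\dashv_p UF$. Only triangle
isomorphisms have to be exhibited, because `exists_pseudoadjunction` supplies coherence. -/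
theorem PseudoAmbijunction.exists_frobenius_adjunction {F : K.Hom B A} {U : K.Hom A B}
    (P : PseudoAmbijunction F U) :
    ∃ adj : Pseudoadjunction P.left.induced.T P.left.induced.T,
      adj.e = P.left.induced.μ ≫ P.right.e := by
  obtain ⟨⟨i, e, I, I_dom, I_cod, E, E_dom, E_cod, -, -⟩,
    -- `L` is the isomorphism $k U\circ Uj\to 1_U$, the letter `K` being taken by the Gray-category.
    ⟨j, k, J, J_dom, J_cod, L, L_dom, L_cod, -, -⟩⟩ := P
  refine exists_pseudoadjunction (F := U ⊙ F) (U := U ⊙ F)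
    (i ≫ (U ⊙ₗ (⟨j⟩ ⊙ᵣ F)).homOf) ((U ⊙ₗ (⟨e⟩ ⊙ᵣ F)).homOf ≫ k)
    -- Insert $IF$, then $UJ$, and use $j_e^{-1}$ to move $j$ ahead of $e$.
    (((I ⊚ᵣ F).vcomp (whiskerL ((⟨i⟩ ⊙ᵣ (U ⊙ F)).comp (U ⊙ₗ ⟨e⟩ ⊙ᵣ F)) (U ⊚ₗ J))).vcomp
      (whiskerL (⟨i⟩ ⊙ᵣ (U ⊙ F)) ((U ⊚ₗ swap ⟨j⟩ ⟨e⟩ ⊚ᵣ F).symm.whiskerR (U ⊙ₗ F ⊙ₗ ⟨k⟩))))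
    ?_ ?_
    -- Dually, $e_j^{-1}$ moves $e$ ahead of $j$, so that $UE$ and then $LF$ can cancel.
    (((whiskerL (U ⊙ₗ F ⊙ₗ ⟨i⟩) ((U ⊚ₗ swap ⟨e⟩ ⟨j⟩ ⊚ᵣ F).symm.whiskerR (⟨k⟩ ⊙ᵣ (U ⊙ F)))).vcomp
      ((U ⊚ₗ E).whiskerR ((U ⊙ₗ ⟨j⟩ ⊙ᵣ F).comp (⟨k⟩ ⊙ᵣ (U ⊙ F))))).vcomp (L ⊚ᵣ F))
    ?_ ?_
  · simp [*]
  · simp [*, mk_comp_eq]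
  · simp [*, mk_comp_eq]
  · simp [*]

/-! ### Passage to the Gray-monoid $\mathcal K(B,B)$. -/

/-- Composition, whiskering and interchangers of `K.endo B` are by definition those of `K` at `B`,
so every axiom transfers unchanged. -/
theorem PseudomonadData.IsPseudomonad.toEndo {D : PseudomonadData K B} (h : D.IsPseudomonad) :
    D.toEndo.IsPseudomonad :=
  ⟨h.lam_dom, h.lam_cod, h.rho_dom, h.rho_cod, h.alpha_dom, h.alpha_cod, h.pentagon, h.unit_law⟩

/-- A pseudoadjunction of endomorphisms of `B`, viewed in the Gray-monoid `K(B,B)`. -/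
def Pseudoadjunction.toEndo {F U : K.Hom B B} (adj : Pseudoadjunction F U) :
    Pseudoadjunction (K := (K.endo B).toGrayCategory) (A := default) (B := default) F U where
  i := adj.i
  e := adj.e
  I := adj.I
  I_dom := adj.I_dom
  I_cod := adj.I_cod
  E := adj.E
  E_dom := adj.E_dom
  E_cod := adj.E_cod
  counit_law := adj.counit_law
  unit_law := adj.unit_law

end Pseudo

end Gray

theorem mainTheorem8 (K : Gray.GrayCategory.{u, v, w, z}) {A B : K.Obj}
    (F : K.Hom B A) (U : K.Hom A B) (P : Gray.PseudoAmbijunction F U) :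
    P.left.induced.IsFrobeniusPseudomonad P.right.e ∧
      Gray.PseudomonoidData.IsFrobeniusPseudomonoid P.left.induced.toEndo P.right.e := by
  have h := P.left.induced_isPseudomonad
  obtain ⟨adj, hadj⟩ := P.exists_frobenius_adjunction
  exact ⟨⟨h, adj, hadj⟩, h.toEndo, adj.toEndo, hadj⟩
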